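/- Let $m,N\ge 0$ be integers, $M=2^m$, and for $0\le i\le M-1$ let $n_{i,k}\in\{0,1\}$ ($k=0,\dots,m-1$) be the coefficient of $2^k$ in the binary representation of $i$; write $\bar u=1-u$ for a bit $u$. Let $C_0,\dots,C_{m-1}$ be independent random bits with $P_{C_k}(u)=\Pr[C_k=u]$ and $0<P_{C_k}(0)<1$. Let $x_0,\dots,x_{M-1}\in\mathbb{R}^N$ be symbols, not all zero. The transmitted vector $X$ is the symbol $x_i$ whose index satisfies $n_{i,k}=C_k$ for all $k$; thus the index $i$ has probability $P_i=\prod_{k=0}^{m-1}P_{C_k}(n_{i,k})$. The received vector is $Y=H\circ X+Z$ (element-wise product), where $X,H,Z$ are independent, $Z$ is Gaussian with independent coordinates of mean zero and variance $N_0/2$ (with $N_0>0$), and $H$ is a random vector in $\mathbb{R}^N$ whose real coordinates, possibly dependent, all have the same law as a random variable $H_*$ with $0<\mathbb{E}[H_*^2]<\infty$. Put $\boldsymbol\mu=\mathbb{E}[X]$, $E_s=\mathbb{E}[\|X\|^2]$, $\mathrm{SNR}=\mathbb{E}[H_*^2]E_s/N_0$, and let the BICM generalized mutual information be $$I=\sum_{k=0}^{m-1}I(C_k;Y\mid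 H),\qquad I(C_k;Y\mid H)=\mathbb{E}\left[\log_2\frac{p_{Y|H,C_k}(Y|H,C_k)}{p_{Y|H}(Y|H)}\right].$$ Then $$\boldsymbol\mu=\sum_{i=0}^{M-1}P_i x_i,\qquad E_s=\sum_{i=0}^{M-1}P_i\|x_i\|^2 .$$ The random variables in the definition of $I(C_k;Y\mid H)$ are integrable. When $N_0>0$ is varied, and when the alphabet is replaced by $(r x_i)_i$ with $r\ge 0$ (and $E_s$ accordingly), the value $I$ depends only on $\mathrm{SNR}$, so that $I=I(\mathrm{SNR})$ is a function on $[0,\infty)$. This function has a (right) derivative $\alpha=\left.\frac{dI(\mathrm{SNR})}{d\,\mathrm{SNR}}\right|_{\mathrm{SNR}=0}$, and, with $E_s$ the energy of the original alphabet, $$\alpha=\frac{\log_2 e}{E_s}\sum_{i=0}^{M-1}P_i\sum_{j=0}^{M-1}P_j\langle x_i,x_j\rangle\sum_{k=0}^{m-1}(-1)^{n_{i,k}+n_{j,k}}\frac{P_{C_k}(\bar n_{i,k})}{P_{C_k}(n_{j,k})}.$$ -/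

import Mathlib

open MeasureTheory

noncomputable section

namespace BICM

/-- The bit `n_{i,k}` of the natural binary code: the coefficient of `2 ^ k` in the base-2
representation of `i`, so that `k = m - 1` is the most significant position. -/
def nbc {m : ℕ} (i : Fin (2 ^ m)) (k : Fin m) : Fin 2 :=
  ⟨(i : ℕ) / 2 ^ (k : ℕ) % 2, Nat.mod_lt _ two_pos⟩

/-- Element-wise product of two vectors. -/
def hadamard {N : ℕ} (a b : EuclideanSpace ℝ (Fin N)) : EuclideanSpace ℝ (Fin N) :=
  WithLp.toLp 2 fun l => a l * b l

/-- A constellation with `2 ^ m` symbols in `ℝ^N`, labelled by the natural binary code. The input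
distribution is specified by the bit probabilities `b k`, the probability that bit `k` is `0`. -/
structure Constellation (m N : ℕ) where
  /-- the input alphabet -/
  x : Fin (2 ^ m) → EuclideanSpace ℝ (Fin N)
  /-- the probability that bit `k` is `0` -/
  b : Fin m → ℝ
  b_pos : ∀ k, 0 < b k
  b_lt_one : ∀ k, b k < 1

namespace Constellation

variable {m N : ℕ}

/-- The probability `P_{C_k}(u)` that bit `k` equals `u`. -/
def bitProb (C : Constellation m N) (k : Fin m) (u : Fin 2) : ℝ :=
  if u = 0 then C.b k else 1 - C.b k

/-- The symbol probability `P_i`. -/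
def symbolProb (C : Constellation m N) (i : Fin (2 ^ m)) : ℝ :=
  ∏ k, C.bitProb k (nbc i k)

/-- The law of the bit vector `(C_0, …, C_{m-1})`: independent bits. -/
def bitsLaw (C : Constellation m N) : Measure (Fin m → Fin 2) :=
  Measure.pi fun k => ∑ u : Fin 2, ENNReal.ofReal (C.bitProb k u) • Measure.dirac u

/-- The mapper: a bit vector `c` is sent to the symbol whose index is `∑ k, c k * 2 ^ k`. -/
def symbol (C : Constellation m N) (c : Fin m → Fin 2) : EuclideanSpace ℝ (Fin N) :=
  C.x (finFunctionFinEquiv c)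

/-- The mean `E[X]` of the transmitted symbol. -/
def mean (C : Constellation m N) : EuclideanSpace ℝ (Fin N) :=
  ∫ c, C.symbol c ∂C.bitsLaw

/-- The average symbol energy `E_s = E[‖X‖²]`. -/
def energy (C : Constellation m N) : ℝ :=
  ∫ c, ‖C.symbol c‖ ^ 2 ∂C.bitsLaw

/-- The alphabet rescaled linearly, with the same input distribution. -/
def scale (C : Constellation m N) (r : ℝ) : Constellation m N :=
  { C with x := fun i => r • C.x i }

end Constellation

variable {m N : ℕ}

/-- The transition pdf `p_{Y|X,H}(y|x,h)` of the channel `Y = H ∘ X + Z`. -/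
def channelPdf (N₀ : ℝ) (y x h : EuclideanSpace ℝ (Fin N)) : ℝ :=
  1 / (N₀ * Real.pi) ^ ((N : ℝ) / 2) * Real.exp (-‖y - hadamard h x‖ ^ 2 / N₀)

/-- The pdf `p_{Y|H}(y|h)`. -/
def outputPdf (C : Constellation m N) (N₀ : ℝ) (y h : EuclideanSpace ℝ (Fin N)) : ℝ :=
  ∑ i, C.symbolProb i * channelPdf N₀ y (C.x i) h

/-- The pdf `p_{Y|H,C_k}(y|h,u)`. -/
def bitOutputPdf (C : Constellation m N) (N₀ : ℝ) (k : Fin m) (y h : EuclideanSpace ℝ (Fin N))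
    (u : Fin 2) : ℝ :=
  ∑ i with nbc i k = u, C.symbolProb i / C.bitProb k u * channelPdf N₀ y (C.x i) h

/-- The law of the noise `Z`: i.i.d. Gaussian coordinates with mean `0` and variance `N₀ / 2`. -/
def noiseLaw (N : ℕ) (N₀ : ℝ) : Measure (EuclideanSpace ℝ (Fin N)) :=
  volume.withDensity fun z =>
    ENNReal.ofReal (1 / (N₀ * Real.pi) ^ ((N : ℝ) / 2) * Real.exp (-‖z‖ ^ 2 / N₀))

/-- The joint law of the bits, the fading vector `H` (with law `ν`) and the noise `Z`, which are
independent of each other. -/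
def jointLaw (C : Constellation m N) (ν : Measure (EuclideanSpace ℝ (Fin N))) (N₀ : ℝ) :
    Measure ((Fin m → Fin 2) × EuclideanSpace ℝ (Fin N) × EuclideanSpace ℝ (Fin N)) :=
  C.bitsLaw.prod (ν.prod (noiseLaw N N₀))

/-- The received vector `Y = H ∘ X + Z`. -/
def received (C : Constellation m N)
    (ω : (Fin m → Fin 2) × EuclideanSpace ℝ (Fin N) × EuclideanSpace ℝ (Fin N)) :
    EuclideanSpace ℝ (Fin N) :=
  hadamard ω.2.1 (C.symbol ω.1) + ω.2.2

/-- The information density `log₂ (p_{Y|H,C_k}(Y|H,C_k) / p_{Y|H}(Y|H))`. -/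
def infoDensity (C : Constellation m N) (N₀ : ℝ) (k : Fin m)
    (ω : (Fin m → Fin 2) × EuclideanSpace ℝ (Fin N) × EuclideanSpace ℝ (Fin N)) : ℝ :=
  Real.logb 2 (bitOutputPdf C N₀ k (received C ω) ω.2.1 (ω.1 k) /
    outputPdf C N₀ (received C ω) ω.2.1)

/-- The mutual information `I(C_k; Y | H)` in bits per channel use. -/
def bitMI (C : Constellation m N) (ν : Measure (EuclideanSpace ℝ (Fin N))) (N₀ : ℝ)
    (k : Fin m) : ℝ :=
  ∫ ω, infoDensity C N₀ k ω ∂jointLaw C ν N₀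

/-- The BICM generalized mutual information `∑ k, I(C_k; Y | H)`. -/
def bicmGMI (C : Constellation m N) (ν : Measure (EuclideanSpace ℝ (Fin N))) (N₀ : ℝ) : ℝ :=
  ∑ k, bitMI C ν N₀ k

/-- The second moment `E[H²]` of a fading coefficient with law `pH`. -/
def secondMoment (pH : Measure ℝ) : ℝ := ∫ t, t ^ 2 ∂pH

/-- The signal-to-noise ratio `E[H²] E_s / N₀`. -/
def snr (C : Constellation m N) (pH : Measure ℝ) (N₀ : ℝ) : ℝ :=
  secondMoment pH * C.energy / N₀

/-- The BICM-GMI as a function of the SNR: the alphabet is rescaled, at noise level `N₀ = 1`,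
so that the SNR becomes `s`. -/
def gmiOfSNR (C : Constellation m N) (ν : Measure (EuclideanSpace ℝ (Fin N))) (pH : Measure ℝ)
    (s : ℝ) : ℝ :=
  bicmGMI (C.scale (Real.sqrt (s / (secondMoment pH * C.energy)))) ν 1

end BICM

end

noncomputable section

namespace BICM

open Filter Topology Asymptotics InformationTheory

/-! Fix unit noise level and compare every output law with the law of the noise alone. The
likelihood ratio of `a + Z` to `Z` is `likelihood a`, so the conditional and unconditional outputs
have ratios of the form `mixture w a`. By the compensation identity (`sum_symbolProb_mul_logRatio`,
`bitMI_one`), the information of bit `k` is the average over its value `u` of the relative entropy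
of the output given `u`, minus that of the unconditional output, with both entropies taken relative
to the noise and averaged over the fading.

At amplitude `r` a mixture ratio is `1 + 2r⟨z, μ⟩ + O(r²)` with `μ` the mean signal, and `klFun (1 +
d) ~ d² / 2`. Hence its relative entropy is `r²‖μ‖² + o(r²)` (`tendsto_mixtureKL_smul_div_sq`). Two
dominated convergences are needed. Over the noise an exponential bound serves. Over the fading only
second moments exist, and the bound is `mixtureKL_le`, which is quadratic in the signals. The
averages over the fading turn `‖h ∘ μ‖²` into `E[H²]‖μ‖²`.

The derivative is thus the between-class energy of the conditional means, summed over bits;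
`sum_bitProb_mul_norm_sq_sub` expands it into the double sum. Other noise levels reduce to the unit
one by dilating the output (`infoDensity_sq`). -/

/-- Transport of a density along a measurable equivalence. -/
theorem map_withDensity_measurableEquiv {α β : Type*} [MeasurableSpace α] [MeasurableSpace β]
    (μ : Measure α) (e : α ≃ᵐ β) (f : α → ENNReal) :
    (μ.withDensity f).map e = (μ.map e).withDensity (f ∘ e.symm) := by
  ext s hs
  rw [Measure.map_apply e.measurable hs, withDensity_apply _ (e.measurable hs),
    withDensity_apply _ hs, e.restrict_map, lintegral_map_equiv]
  simp

/-! ### Gaussian noise: normalisation, dilation, translation, moments -/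

variable {N : ℕ}

local notation "E" => EuclideanSpace ℝ (Fin N)

/-- The standard Gaussian density of variance `1 / 2` in each coordinate. -/
def unitNoiseDensity (z : E) : ℝ :=
  1 / (1 * Real.pi) ^ ((N : ℝ) / 2) * Real.exp (-‖z‖ ^ 2 / 1)

theorem unitNoiseDensity_nonneg (z : E) : 0 ≤ unitNoiseDensity z := by
  unfold unitNoiseDensity; positivity

theorem continuous_unitNoiseDensity : Continuous (unitNoiseDensity (N := N)) := by
  unfold unitNoiseDensity; fun_prop

theorem unitNoiseDensity_neg (z : E) : unitNoiseDensity (-z) = unitNoiseDensity z := by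
  simp [unitNoiseDensity]

theorem noiseLaw_one :
    noiseLaw N 1 = volume.withDensity fun z => ENNReal.ofReal (unitNoiseDensity z) := rfl

theorem integral_noiseLaw_one (f : E → ℝ) :
    ∫ z, f z ∂noiseLaw N 1 = ∫ z, unitNoiseDensity z * f z := by
  rw [noiseLaw_one, integral_withDensity_eq_integral_toReal_smul
    continuous_unitNoiseDensity.measurable.ennreal_ofReal (by simp)]
  simp [ENNReal.toReal_ofReal (unitNoiseDensity_nonneg _)]

theorem integrable_noiseLaw_one_iff {f : E → ℝ} :
    Integrable f (noiseLaw N 1) ↔ Integrable fun z => unitNoiseDensity z * f z := by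
  rw [noiseLaw_one, integrable_withDensity_iff_integrable_smul'
    continuous_unitNoiseDensity.measurable.ennreal_ofReal (by simp)]
  simp [ENNReal.toReal_ofReal (unitNoiseDensity_nonneg _)]

theorem integrable_exp_neg_mul_sq_norm {b : ℝ} (hb : 0 < b) :
    Integrable fun z : E => Real.exp (-b * ‖z‖ ^ 2) := by
  -- A non-integrable function has Bochner integral `0`, but the Gaussian integral formula gives a
  -- positive value.
  by_contra h
  have h1 := GaussianFourier.integral_rexp_neg_mul_sq_norm (V := E) hb
  rw [integral_undef h] at h1
  have : 0 < (Real.pi / b) ^ ((Module.finrank ℝ E : ℝ) / 2) := by positivity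
  exact this.ne h1

instance isProbabilityMeasure_noiseLaw_one : IsProbabilityMeasure (noiseLaw N 1) := by
  have hint : Integrable (unitNoiseDensity (N := N)) := by
    have := (integrable_exp_neg_mul_sq_norm (N := N) one_pos).const_mul
      (1 / (1 * Real.pi) ^ ((N : ℝ) / 2))
    exact this.congr (.of_forall fun z => by simp [unitNoiseDensity])
  constructor
  rw [noiseLaw_one, withDensity_apply _ MeasurableSet.univ, setLIntegral_univ,
    ← ofReal_integral_eq_lintegral_ofReal hint (.of_forall unitNoiseDensity_nonneg)]
  have h1 := GaussianFourier.integral_rexp_neg_mul_sq_norm (V := E) one_pos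
  have h2 : ∫ z : E, unitNoiseDensity z = 1 := by
    unfold unitNoiseDensity
    rw [integral_const_mul]
    simp only [neg_mul, one_mul, div_one, finrank_euclideanSpace, Fintype.card_fin] at h1 ⊢
    rw [h1]
    have : (0 : ℝ) < Real.pi ^ ((N : ℝ) / 2) := by positivity
    field_simp
  simp [h2]

theorem noiseLaw_sq_eq_map {c : ℝ} (hc : 0 < c) :
    noiseLaw N (c ^ 2) = (noiseLaw N 1).map (c • ·) := by
  have hmap := map_withDensity_measurableEquiv (volume : Measure E)
    (MeasurableEquiv.smul₀ c hc.ne') fun z => ENNReal.ofReal (unitNoiseDensity z)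
  have hvol : (volume : Measure E).map (MeasurableEquiv.smul₀ c hc.ne') =
      ENNReal.ofReal |(c ^ Module.finrank ℝ E)⁻¹| • volume :=
    Measure.map_addHaar_smul volume hc.ne'
  rw [hvol, withDensity_smul_measure, ← withDensity_smul' _ _ ENNReal.ofReal_ne_top] at hmap
  change _ = (noiseLaw N 1).map (MeasurableEquiv.smul₀ c hc.ne')
  rw [noiseLaw_one, hmap, noiseLaw]
  congr 1
  ext z
  -- The Jacobian `c⁻ᴺ` of the dilation accounts exactly for the change of normalising constant.
  have hp : (c ^ 2 * Real.pi) ^ ((N : ℝ) / 2) = c ^ N * Real.pi ^ ((N : ℝ) / 2) := by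
    rw [Real.mul_rpow (by positivity) Real.pi_pos.le, ← Real.rpow_natCast c 2, ← Real.rpow_mul hc.le]
    norm_num
    left
    rw [mul_div_cancel₀ _ two_ne_zero, Real.rpow_natCast]
  have hsymm : (MeasurableEquiv.smul₀ c hc.ne').symm z = c⁻¹ • z := rfl
  simp only [Pi.smul_apply, Function.comp_apply, hsymm, smul_eq_mul]
  rw [← ENNReal.ofReal_mul (abs_nonneg _), unitNoiseDensity, hp, abs_of_pos (by positivity),
    norm_smul, finrank_euclideanSpace, Fintype.card_fin, norm_inv, Real.norm_of_nonneg hc.le]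
  congr 1
  have e : -(c⁻¹ * ‖z‖) ^ 2 / 1 = -‖z‖ ^ 2 / c ^ 2 := by field_simp
  rw [e, one_mul]
  have : (0 : ℝ) < Real.pi ^ ((N : ℝ) / 2) := by positivity
  field_simp

/-- The likelihood ratio of `a + Z` with respect to `Z`, for noise of variance `1 / 2`. -/
def likelihood (a z : E) : ℝ := Real.exp (2 * inner ℝ z a - ‖a‖ ^ 2)

theorem likelihood_pos (a z : E) : 0 < likelihood a z := Real.exp_pos _

theorem continuous_likelihood (a : E) : Continuous (likelihood a) := by
  unfold likelihood; fun_prop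

theorem unitNoiseDensity_sub (a z : E) :
    unitNoiseDensity (z - a) = unitNoiseDensity z * likelihood a z := by
  unfold unitNoiseDensity likelihood
  rw [mul_assoc, ← Real.exp_add, norm_sub_sq_real]
  ring_nf

/-- Translation invariance of Lebesgue measure moves the shift from the integrand to the Gaussian
density, where it appears as the likelihood ratio. -/
theorem integral_noiseLaw_one_add (a : E) (f : E → ℝ) :
    ∫ z, f (a + z) ∂noiseLaw N 1 = ∫ z, likelihood a z * f z ∂noiseLaw N 1 := by
  rw [integral_noiseLaw_one, integral_noiseLaw_one,
    ← integral_sub_right_eq_self (fun z => unitNoiseDensity z * f (a + z)) a]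
  simp [unitNoiseDensity_sub, mul_assoc]

theorem integrable_noiseLaw_one_add (a : E) {f : E → ℝ} :
    Integrable (fun z => f (a + z)) (noiseLaw N 1) ↔
      Integrable (fun z => likelihood a z * f z) (noiseLaw N 1) := by
  rw [integrable_noiseLaw_one_iff, integrable_noiseLaw_one_iff,
    ← (measurePreserving_sub_right volume a).integrable_comp_emb
      (MeasurableEquiv.subRight a).measurableEmbedding]
  simp [Function.comp_def, unitNoiseDensity_sub, mul_assoc]

/-- Completing the square, `c t - t² ≤ c² / 2 - t² / 2`, leaves a Gaussian majorant. All moments and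
dominating functions of the noise come from here. -/
theorem integrable_exp_mul_norm (c : ℝ) :
    Integrable (fun z : E => Real.exp (c * ‖z‖)) (noiseLaw N 1) := by
  rw [integrable_noiseLaw_one_iff]
  refine ((integrable_exp_neg_mul_sq_norm (N := N) (b := 1 / 2) (by norm_num)).const_mul
    (1 / (1 * Real.pi) ^ ((N : ℝ) / 2) * Real.exp (c ^ 2 / 2))).mono'
    (continuous_unitNoiseDensity.mul (by fun_prop)).aestronglyMeasurable (.of_forall fun z => ?_)
  rw [Real.norm_of_nonneg (mul_nonneg (unitNoiseDensity_nonneg z) (Real.exp_pos _).le),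
    unitNoiseDensity, mul_assoc, mul_assoc, ← Real.exp_add, ← Real.exp_add]
  refine mul_le_mul_of_nonneg_left (Real.exp_le_exp.2 ?_) (by positivity)
  nlinarith [sq_nonneg (c - ‖z‖)]

theorem integrable_norm_noiseLaw_one : Integrable (fun z : E => ‖z‖) (noiseLaw N 1) := by
  refine (integrable_exp_mul_norm (N := N) 1).mono' (by fun_prop) (.of_forall fun z => ?_)
  rw [norm_norm, one_mul]
  linarith [Real.add_one_le_exp ‖z‖]

theorem integrable_sq_norm_noiseLaw_one : Integrable (fun z : E => ‖z‖ ^ 2) (noiseLaw N 1) := by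
  refine (integrable_exp_mul_norm (N := N) 2).mono' (by fun_prop) (.of_forall fun z => ?_)
  rw [Real.norm_of_nonneg (by positivity), mul_comm, Real.exp_mul, Real.rpow_two]
  gcongr
  linarith [Real.add_one_le_exp ‖z‖]

theorem integrable_inner_noiseLaw_one (a : E) :
    Integrable (fun z : E => inner ℝ z a) (noiseLaw N 1) :=
  (integrable_norm_noiseLaw_one.mul_const ‖a‖).mono' (by fun_prop)
    (.of_forall fun z => norm_inner_le_norm z a)

/-- The density is even and the integrand odd, so the integral equals its own negative. -/
theorem integral_inner_noiseLaw_one (a : E) : ∫ z : E, inner ℝ z a ∂noiseLaw N 1 = 0 := by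
  have h : ∫ z : E, inner ℝ z a ∂noiseLaw N 1 = -∫ z : E, inner ℝ z a ∂noiseLaw N 1 := by
    rw [integral_noiseLaw_one, ← integral_neg,
      ← integral_neg_eq_self (fun z : E => unitNoiseDensity z * inner ℝ z a)]
    simp [unitNoiseDensity_neg]
  linarith

theorem integrable_likelihood (a : E) : Integrable (likelihood a) (noiseLaw N 1) := by
  simpa using (integrable_noiseLaw_one_add a (f := fun _ => (1 : ℝ))).1 (integrable_const _)

theorem integral_likelihood (a : E) : ∫ z, likelihood a z ∂noiseLaw N 1 = 1 := by
  simpa using (integral_noiseLaw_one_add a (fun _ => (1 : ℝ))).symm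

/-! ### The function `klFun` near `1` -/

theorem klFun_le_sq {x : ℝ} (hx : 0 < x) : klFun x ≤ (x - 1) ^ 2 := by
  rw [klFun_apply]
  nlinarith [Real.log_le_sub_one_of_pos hx]

theorem abs_exp_sub_one_le_mul_exp (t : ℝ) : |Real.exp t - 1| ≤ |t| * Real.exp |t| := by
  rcases le_total 0 t with ht | ht
  · rw [abs_of_nonneg ht, abs_of_nonneg (by linarith [Real.one_le_exp ht])]
    have h := mul_le_mul_of_nonneg_left (Real.add_one_le_exp (-t)) (Real.exp_pos t).le
    rw [← Real.exp_add, add_neg_cancel, Real.exp_zero] at h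
    linarith
  · rw [abs_of_nonpos ht, abs_of_nonpos (by linarith [Real.exp_le_one_iff.2 ht])]
    nlinarith [Real.add_one_le_exp t, Real.one_le_exp (neg_nonneg.2 ht)]

theorem abs_klFun_one_add_sub_le {d : ℝ} (hd : |d| ≤ 1 / 2) :
    |klFun (1 + d) - d ^ 2 / 2| ≤ 4 * |d| ^ 3 := by
  -- Second-order Taylor expansion of `log (1 + d)`. The remainder `|d|³ / (1 - |d|)` is at most
  -- `2|d|³` since `|d| ≤ 1 / 2`.
  have h := Real.abs_log_sub_add_sum_range_le (x := -d) (by rw [abs_neg]; linarith) 2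
  simp only [Finset.sum_range_succ, Finset.sum_range_zero, abs_neg, sub_neg_eq_add] at h
  norm_num at h
  set R := -d + d ^ 2 / 2 + Real.log (1 + d) with hR
  have hR' : |R| ≤ 2 * |d| ^ 3 := by
    refine h.trans ?_
    rw [div_le_iff₀ (by linarith)]
    nlinarith [pow_nonneg (abs_nonneg d) 3]
  have hlog : Real.log (1 + d) = R + d - d ^ 2 / 2 := by rw [hR]; ring
  have e : klFun (1 + d) - d ^ 2 / 2 = -d ^ 3 / 2 + (1 + d) * R := by
    rw [klFun_apply, hlog]; ring
  have h1 : |1 + d| ≤ 3 / 2 := (abs_add_le _ _).trans (by rw [abs_one]; linarith)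
  rw [e]
  refine (abs_add_le _ _).trans ?_
  rw [abs_mul, abs_div, abs_neg, abs_pow, abs_two]
  nlinarith [mul_le_mul h1 hR' (abs_nonneg _) (by norm_num), pow_nonneg (abs_nonneg d) 3]

theorem klFun_sub_isLittleO :
    (fun x : ℝ => klFun x - (x - 1) ^ 2 / 2) =o[𝓝 1] fun x => (x - 1) ^ 2 := by
  have h3 : (fun x : ℝ => klFun x - (x - 1) ^ 2 / 2) =O[𝓝 1] fun x => (x - 1) ^ 3 := by
    refine IsBigO.of_bound 4 ?_
    filter_upwards [Metric.closedBall_mem_nhds (1 : ℝ) (show (0 : ℝ) < 1 / 2 by norm_num)] with x hx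
    have := abs_klFun_one_add_sub_le (d := x - 1) (by simpa [Real.dist_eq] using hx)
    simpa [abs_pow] using this
  refine h3.trans_isLittleO ?_
  have h0 : (fun x : ℝ => x - 1) =o[𝓝 1] fun _ => (1 : ℝ) := by
    rw [isLittleO_one_iff]
    exact tendsto_sub_nhds_zero_iff.2 tendsto_id
  exact ((isBigO_refl (fun x : ℝ => (x - 1) ^ 2) (𝓝 1)).mul_isLittleO h0).congr
    (fun x => by ring) fun x => by ring

/-- If `f` tends to `1` differentiably, then `klFun ∘ f` vanishes to second order. -/
theorem tendsto_klFun_div_sq {f : ℝ → ℝ} {f' : ℝ} (hf : HasDerivAt f f' 0) (h0 : f 0 = 1) :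
    Tendsto (fun r => klFun (f r) / r ^ 2) (𝓝[≠] 0) (𝓝 (f' ^ 2 / 2)) := by
  have hs : Tendsto (fun r => (f r - 1) / r) (𝓝[≠] 0) (𝓝 f') := by
    refine (hasDerivAt_iff_tendsto_slope.1 hf).congr fun r => ?_
    rw [slope_def_field, h0, sub_zero]
  have hlim : Tendsto f (𝓝[≠] 0) (𝓝 1) := h0 ▸ hf.continuousAt.tendsto.mono_left inf_le_left
  have hO : (fun r => (f r - 1) ^ 2) =O[𝓝[≠] 0] fun r => r ^ 2 := by
    have := hf.isBigO_sub.pow 2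
    simp only [h0, sub_zero] at this
    exact this.mono nhdsWithin_le_nhds
  have hlo := ((klFun_sub_isLittleO.comp_tendsto hlim).trans_isBigO hO).tendsto_div_nhds_zero
  have := hlo.add ((hs.pow 2).div_const 2)
  rw [zero_add] at this
  refine this.congr' ?_
  filter_upwards [self_mem_nhdsWithin] with r (hr : r ≠ 0)
  simp only [Function.comp_apply]
  field_simp
  ring

/-! ### Relative entropy of a Gaussian mixture at small amplitude -/

section Mixture

variable {ι : Type*} [Fintype ι]

/-- The likelihood ratio, with respect to the noise alone, of a mixture of signals in noise of
variance `1 / 2`. -/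
def mixture (w : ι → ℝ) (a : ι → E) (z : E) : ℝ := ∑ i, w i * likelihood (a i) z

/-- The relative entropy of a mixture of noisy signals with respect to the noise. -/
def mixtureKL (w : ι → ℝ) (a : ι → E) : ℝ := ∫ z, klFun (mixture w a z) ∂noiseLaw N 1

theorem continuous_mixture (w : ι → ℝ) (a : ι → E) : Continuous (mixture w a) :=
  continuous_finsetSum _ fun i _ => continuous_const.mul (continuous_likelihood (a i))

theorem mixture_le_exp {w : ι → ℝ} (hw : w ∈ stdSimplex ℝ ι) {a : ι → E} {z : E} {b : ℝ}
    (hb : ∀ i, 2 * inner ℝ z (a i) - ‖a i‖ ^ 2 ≤ b) : mixture w a z ≤ Real.exp b := by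
  calc mixture w a z ≤ ∑ i, w i * Real.exp b :=
        Finset.sum_le_sum fun i _ => mul_le_mul_of_nonneg_left (Real.exp_le_exp.2 (hb i)) (hw.1 i)
    _ = Real.exp b := by rw [← Finset.sum_mul, hw.2, one_mul]

theorem exp_le_mixture {w : ι → ℝ} (hw : w ∈ stdSimplex ℝ ι) {a : ι → E} {z : E} {b : ℝ}
    (hb : ∀ i, b ≤ 2 * inner ℝ z (a i) - ‖a i‖ ^ 2) : Real.exp b ≤ mixture w a z := by
  calc Real.exp b = ∑ i, w i * Real.exp b := by rw [← Finset.sum_mul, hw.2, one_mul]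
    _ ≤ mixture w a z :=
        Finset.sum_le_sum fun i _ => mul_le_mul_of_nonneg_left (Real.exp_le_exp.2 (hb i)) (hw.1 i)

theorem mixture_pos {w : ι → ℝ} (hw : w ∈ stdSimplex ℝ ι) (a : ι → E) (z : E) :
    0 < mixture w a z := by
  -- Minus the sum of the absolute exponents lies below every exponent, so no index of positive
  -- weight has to be chosen.
  refine (Real.exp_pos _).trans_le (exp_le_mixture hw
    (b := -∑ j, |2 * inner ℝ z (a j) - ‖a j‖ ^ 2|) fun i => ?_)
  have := Finset.single_le_sum (f := fun j => |2 * inner ℝ z (a j) - ‖a j‖ ^ 2|)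
    (fun j _ => abs_nonneg _) (Finset.mem_univ i)
  linarith [neg_abs_le (2 * inner ℝ z (a i) - ‖a i‖ ^ 2)]

/-- A convex combination of exponentials lies between the exponentials of any common bounds on the
exponents, so its logarithm obeys the same bounds. -/
theorem abs_log_mixture_le {w : ι → ℝ} (hw : w ∈ stdSimplex ℝ ι) (a : ι → E) (z : E) :
    |Real.log (mixture w a z)| ≤ ∑ i, |2 * inner ℝ z (a i) - ‖a i‖ ^ 2| := by
  have h i := Finset.single_le_sum (f := fun j => |2 * inner ℝ z (a j) - ‖a j‖ ^ 2|)
    (fun j _ => abs_nonneg _) (Finset.mem_univ i)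
  rw [abs_le, Real.le_log_iff_exp_le (mixture_pos hw a z),
    Real.log_le_iff_le_exp (mixture_pos hw a z)]
  exact ⟨exp_le_mixture hw fun i => by linarith [neg_abs_le (2 * inner ℝ z (a i) - ‖a i‖ ^ 2), h i],
    mixture_le_exp hw fun i => (le_abs_self _).trans (h i)⟩

theorem abs_exponent_smul_le {r : ℝ} (hr : |r| ≤ 1) (a z : E) {A : ℝ} (hA : ‖a‖ ≤ A) :
    |2 * inner ℝ z (r • a) - ‖r • a‖ ^ 2| ≤ |r| * (2 * A * ‖z‖ + A ^ 2) := by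
  have h1 : |2 * inner ℝ z (r • a)| ≤ |r| * (2 * A * ‖z‖) := by
    rw [inner_smul_right, abs_mul, abs_mul, abs_two]
    have := (abs_real_inner_le_norm z a).trans (mul_le_mul_of_nonneg_left hA (norm_nonneg z))
    nlinarith [mul_le_mul_of_nonneg_left this (abs_nonneg r)]
  have h2 : |(‖r • a‖ ^ 2)| ≤ |r| * A ^ 2 := by
    rw [abs_of_nonneg (by positivity), norm_smul, mul_pow, Real.norm_eq_abs]
    have : |r| ^ 2 ≤ |r| := by nlinarith [abs_nonneg r]
    gcongr
  calc _ ≤ |2 * inner ℝ z (r • a)| + |(‖r • a‖ ^ 2)| := abs_sub _ _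
    _ ≤ _ := by linarith

theorem abs_mixture_smul_sub_one_le {w : ι → ℝ} (hw : w ∈ stdSimplex ℝ ι) (a : ι → E) {A : ℝ}
    (hA : ∀ i, ‖a i‖ ≤ A) (hA0 : 0 ≤ A) {r : ℝ} (hr : |r| ≤ 1) (z : E) :
    |mixture w (r • a) z - 1| ≤ |r| * Real.exp (2 * (2 * A * ‖z‖ + A ^ 2)) := by
  set T := 2 * A * ‖z‖ + A ^ 2 with hT
  have hT0 : 0 ≤ T := by positivity
  have e : mixture w (r • a) z - 1 = ∑ i, w i * (likelihood (r • a i) z - 1) := by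
    simp [mixture, mul_sub, Finset.sum_sub_distrib, hw.2]
  have hle i : |likelihood (r • a i) z - 1| ≤ |r| * Real.exp (2 * T) := by
    have ht := abs_exponent_smul_le hr (a i) z (hA i)
    rw [← hT] at ht
    have hrT : |r| * T ≤ T := mul_le_of_le_one_left hT0 hr
    calc _ ≤ _ := abs_exp_sub_one_le_mul_exp _
      _ ≤ (|r| * T) * Real.exp T := by gcongr; exact ht.trans hrT
      _ ≤ (|r| * Real.exp T) * Real.exp T := by
          gcongr; linarith [Real.add_one_le_exp T]
      _ = _ := by rw [mul_assoc, ← Real.exp_add, two_mul]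
  rw [e]
  calc _ ≤ ∑ i, |w i * (likelihood (r • a i) z - 1)| := Finset.abs_sum_le_sum_abs _ _
    _ ≤ ∑ i, w i * (|r| * Real.exp (2 * T)) := Finset.sum_le_sum fun i _ => by
        rw [abs_mul, abs_of_nonneg (hw.1 i)]
        exact mul_le_mul_of_nonneg_left (hle i) (hw.1 i)
    _ = _ := by rw [← Finset.sum_mul, hw.2, one_mul]

/-- The factor `r ^ 2` is explicit, so after division by it the bound dominates uniformly in `|r| ≤
1`; at `r = 1` it gives integrability. -/
theorem klFun_mixture_smul_le {w : ι → ℝ} (hw : w ∈ stdSimplex ℝ ι) (a : ι → E) {A : ℝ}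
    (hA : ∀ i, ‖a i‖ ≤ A) (hA0 : 0 ≤ A) {r : ℝ} (hr : |r| ≤ 1) (z : E) :
    klFun (mixture w (r • a) z) ≤ r ^ 2 * (Real.exp (4 * A ^ 2) * Real.exp (8 * A * ‖z‖)) := by
  refine (klFun_le_sq (mixture_pos hw _ z)).trans ?_
  rw [← sq_abs]
  refine (pow_le_pow_left₀ (abs_nonneg _) (abs_mixture_smul_sub_one_le hw a hA hA0 hr z) 2).trans ?_
  rw [mul_pow, sq_abs, ← Real.exp_nat_mul, ← Real.exp_add]
  push_cast
  ring_nf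
  rfl

theorem exists_norm_le (a : ι → E) : ∃ A, 0 ≤ A ∧ ∀ i, ‖a i‖ ≤ A :=
  ⟨∑ i, ‖a i‖, by positivity, fun i =>
    Finset.single_le_sum (f := fun i => ‖a i‖) (fun _ _ => norm_nonneg _) (Finset.mem_univ i)⟩

theorem klFun_mixture_nonneg {w : ι → ℝ} (hw : w ∈ stdSimplex ℝ ι) (a : ι → E) (z : E) :
    0 ≤ klFun (mixture w a z) := klFun_nonneg (mixture_pos hw a z).le

theorem integrable_klFun_mixture {w : ι → ℝ} (hw : w ∈ stdSimplex ℝ ι) (a : ι → E) :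
    Integrable (fun z => klFun (mixture w a z)) (noiseLaw N 1) := by
  obtain ⟨A, hA0, hA⟩ := exists_norm_le a
  refine ((integrable_exp_mul_norm (8 * A)).const_mul (Real.exp (4 * A ^ 2))).mono'
    (continuous_klFun.comp (continuous_mixture w a)).aestronglyMeasurable (.of_forall fun z => ?_)
  rw [Real.norm_of_nonneg (klFun_mixture_nonneg hw a z)]
  simpa using klFun_mixture_smul_le hw a hA hA0 (r := 1) (by simp) z

theorem mixtureKL_nonneg {w : ι → ℝ} (hw : w ∈ stdSimplex ℝ ι) (a : ι → E) :
    0 ≤ mixtureKL w a := integral_nonneg (klFun_mixture_nonneg hw a)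

theorem hasDerivAt_mixture_smul (w : ι → ℝ) (a : ι → E) (z : E) :
    HasDerivAt (fun r : ℝ => mixture w (r • a) z) (2 * inner ℝ z (∑ i, w i • a i)) 0 := by
  have e : 2 * inner ℝ z (∑ i, w i • a i) = ∑ i, w i * (2 * inner ℝ z (a i)) := by
    simp only [inner_sum, inner_smul_right, Finset.mul_sum]
    exact Finset.sum_congr rfl fun i _ => by ring
  rw [e]
  refine HasDerivAt.fun_sum fun i _ => HasDerivAt.const_mul (w i) ?_
  have h1 : HasDerivAt (fun r : ℝ => 2 * (r * inner ℝ z (a i)) - r ^ 2 * ‖a i‖ ^ 2)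
      (2 * (1 * inner ℝ z (a i)) - (2 * 0) * ‖a i‖ ^ 2) 0 := by
    have h2 := (hasDerivAt_pow 2 (0 : ℝ)).mul_const (‖a i‖ ^ 2)
    have h3 := (((hasDerivAt_id (0 : ℝ)).mul_const (inner ℝ z (a i))).const_mul 2).fun_sub h2
    simpa using h3
  have h4 := h1.exp
  simp only [Pi.smul_apply, likelihood, inner_smul_right, norm_smul, mul_pow, Real.norm_eq_abs,
    sq_abs]
  simpa using h4

theorem mixture_zero_smul {w : ι → ℝ} (hw : w ∈ stdSimplex ℝ ι) (a : ι → E) (z : E) :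
    mixture w ((0 : ℝ) • a) z = 1 := by
  simp [mixture, likelihood, hw.2]

/-- Dominated convergence over the noise. The Gaussian second moment in the limit is left
unevaluated here, because its value is then deduced from this very limit for a one-point mixture. -/
theorem tendsto_mixtureKL_smul_div_sq_aux {w : ι → ℝ} (hw : w ∈ stdSimplex ℝ ι) (a : ι → E) :
    Tendsto (fun r : ℝ => mixtureKL w (r • a) / r ^ 2) (𝓝[≠] 0)
      (𝓝 (∫ z, (2 * inner ℝ z (∑ i, w i • a i)) ^ 2 / 2 ∂noiseLaw N 1)) := by
  obtain ⟨A, hA0, hA⟩ := exists_norm_le a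
  simp only [mixtureKL, ← integral_div]
  refine tendsto_integral_filter_of_dominated_convergence
    (fun z => Real.exp (4 * A ^ 2) * Real.exp (8 * A * ‖z‖)) (.of_forall fun r => ?_) ?_
    ((integrable_exp_mul_norm (8 * A)).const_mul _) (.of_forall fun z =>
      tendsto_klFun_div_sq (hasDerivAt_mixture_smul w a z) (mixture_zero_smul hw a z))
  · exact ((integrable_klFun_mixture hw _).div_const _).aestronglyMeasurable
  · filter_upwards [self_mem_nhdsWithin, nhdsWithin_le_nhds
      (Metric.closedBall_mem_nhds (0 : ℝ) one_pos)] with r (hr0 : r ≠ 0) hr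
    refine .of_forall fun z => ?_
    rw [Real.norm_of_nonneg (div_nonneg (klFun_mixture_nonneg hw _ z) (sq_nonneg r)),
      div_le_iff₀ (by positivity), mul_comm]
    exact klFun_mixture_smul_le hw a hA hA0 (by simpa using hr) z

theorem klFun_likelihood (a z : E) : klFun (likelihood a z) =
    likelihood a z * (2 * inner ℝ z a - ‖a‖ ^ 2) + 1 - likelihood a z := by
  rw [klFun_apply]
  simp [likelihood]

theorem exponent_add_self (a z : E) :
    2 * inner ℝ (a + z) a - ‖a‖ ^ 2 = ‖a‖ ^ 2 + 2 * inner ℝ z a := by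
  rw [inner_add_left, real_inner_self_eq_norm_sq]
  ring

theorem integrable_likelihood_mul_exponent (a : E) :
    Integrable (fun z => likelihood a z * (2 * inner ℝ z a - ‖a‖ ^ 2)) (noiseLaw N 1) := by
  rw [← integrable_noiseLaw_one_add a (f := fun z => 2 * inner ℝ z a - ‖a‖ ^ 2)]
  simp only [exponent_add_self]
  exact (integrable_const (‖a‖ ^ 2)).add ((integrable_inner_noiseLaw_one a).const_mul 2)

theorem integral_likelihood_mul_exponent (a : E) :
    ∫ z, likelihood a z * (2 * inner ℝ z a - ‖a‖ ^ 2) ∂noiseLaw N 1 = ‖a‖ ^ 2 := by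
  rw [← integral_noiseLaw_one_add a fun z => 2 * inner ℝ z a - ‖a‖ ^ 2]
  simp only [exponent_add_self]
  rw [integral_add (integrable_const _) ((integrable_inner_noiseLaw_one a).const_mul 2),
    integral_const_mul, integral_inner_noiseLaw_one]
  simp

theorem integrable_klFun_likelihood (a : E) :
    Integrable (fun z => klFun (likelihood a z)) (noiseLaw N 1) := by
  simp only [klFun_likelihood]
  exact ((integrable_likelihood_mul_exponent a).add (integrable_const 1)).sub
    (integrable_likelihood a)

/-- The affine part integrates to zero, and the shift by `a` turns the integral of `L log L` into
the mean of `‖a‖² + 2⟨z, a⟩`, whose linear term is centred. -/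
theorem integral_klFun_likelihood (a : E) :
    ∫ z, klFun (likelihood a z) ∂noiseLaw N 1 = ‖a‖ ^ 2 := by
  have h1 := integrable_likelihood_mul_exponent a
  have h2 : Integrable (fun z => likelihood a z * (2 * inner ℝ z a - ‖a‖ ^ 2) + 1)
      (noiseLaw N 1) := h1.add (integrable_const 1)
  simp only [klFun_likelihood]
  rw [integral_sub h2 (integrable_likelihood a),
    integral_add h1 (integrable_const 1), integral_likelihood, integral_likelihood_mul_exponent]
  simp

/-- Convexity of `klFun` reduces to single shifts. Being quadratic in the signals, the bound is
integrable over a fading with finite second moment, where the exponential bound need not be. -/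
theorem mixtureKL_le {w : ι → ℝ} (hw : w ∈ stdSimplex ℝ ι) (a : ι → E) :
    mixtureKL w a ≤ ∑ i, w i * ‖a i‖ ^ 2 := by
  have hint i := (integrable_klFun_likelihood (a i)).const_mul (w i)
  calc mixtureKL w a ≤ ∫ z, ∑ i, w i * klFun (likelihood (a i) z) ∂noiseLaw N 1 :=
        integral_mono (integrable_klFun_mixture hw a) (integrable_finsetSum _ fun i _ => hint i)
          fun z => convexOn_klFun.map_sum_le (fun i _ => hw.1 i) hw.2
            fun i _ => (likelihood_pos (a i) z).le
    _ = ∑ i, w i * ‖a i‖ ^ 2 := by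
        rw [integral_finsetSum _ fun i _ => hint i]
        simp only [integral_const_mul, integral_klFun_likelihood]

/-- The second moment of a Gaussian linear form, read off from the relative entropies. -/
theorem integral_sq_inner_noiseLaw_one (a : E) :
    ∫ z, (2 * inner ℝ z a) ^ 2 / 2 ∂noiseLaw N 1 = ‖a‖ ^ 2 := by
  have hw : (fun _ => 1 : Unit → ℝ) ∈ stdSimplex ℝ Unit := ⟨fun _ => zero_le_one, by simp⟩
  have h := tendsto_mixtureKL_smul_div_sq_aux hw fun _ => a
  simp only [Finset.univ_unique, Finset.sum_singleton, one_smul] at h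
  -- For a single signal the quotient is exactly `‖a‖²` at every `r ≠ 0`, and limits are unique.
  refine tendsto_nhds_unique h (tendsto_const_nhds.congr' ?_)
  filter_upwards [self_mem_nhdsWithin] with r (hr : r ≠ 0)
  have e z : mixture (fun _ => 1 : Unit → ℝ) (r • fun _ => a) z = likelihood (r • a) z := by
    simp [mixture]
  rw [mixtureKL]
  simp only [e, integral_klFun_likelihood, norm_smul, mul_pow, Real.norm_eq_abs, sq_abs]
  field_simp

theorem tendsto_mixtureKL_smul_div_sq {w : ι → ℝ} (hw : w ∈ stdSimplex ℝ ι) (a : ι → E) :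
    Tendsto (fun r : ℝ => mixtureKL w (r • a) / r ^ 2) (𝓝[≠] 0) (𝓝 (‖∑ i, w i • a i‖ ^ 2)) := by
  simpa only [integral_sq_inner_noiseLaw_one] using tendsto_mixtureKL_smul_div_sq_aux hw a

end Mixture

/-! ### Bit labels, element-wise products and second moments of the fading -/

variable {m : ℕ}

theorem nbc_finFunctionFinEquiv (c : Fin m → Fin 2) (k : Fin m) :
    nbc (finFunctionFinEquiv c) k = c k :=
  congrFun (finFunctionFinEquiv.symm_apply_apply c) k

theorem hadamard_apply (h x : E) (l : Fin N) : hadamard h x l = h l * x l := rfl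

theorem hadamard_smul (h x : E) (r : ℝ) : hadamard h (r • x) = r • hadamard h x := by
  ext l
  simp [hadamard_apply, mul_left_comm]

theorem hadamard_sum {ι : Type*} (s : Finset ι) (h : E) (w : ι → ℝ) (x : ι → E) :
    hadamard h (∑ i ∈ s, w i • x i) = ∑ i ∈ s, w i • hadamard h (x i) := by
  ext l
  simp [hadamard_apply, Finset.mul_sum, mul_left_comm]

theorem continuous_hadamard_left (x : E) : Continuous fun h : E => hadamard h x := by
  unfold hadamard
  fun_prop

theorem norm_sq_hadamard (h x : E) : ‖hadamard h x‖ ^ 2 = ∑ l, h l ^ 2 * x l ^ 2 := by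
  simp [EuclideanSpace.norm_sq_eq, hadamard_apply, mul_pow]

section Fading

variable {ν : Measure (EuclideanSpace ℝ (Fin N))} {pH : Measure ℝ}

theorem integrable_sq_coord (hν : ∀ l, ν.map (fun h => h l) = pH)
    (hH : Integrable (fun t : ℝ => t ^ 2) pH) (l : Fin N) : Integrable (fun h : E => h l ^ 2) ν := by
  rw [← hν l] at hH
  exact hH.comp_measurable (by fun_prop)

theorem integral_sq_coord (hν : ∀ l, ν.map (fun h => h l) = pH) (l : Fin N) :
    ∫ h : E, h l ^ 2 ∂ν = secondMoment pH := by
  rw [secondMoment, ← hν l, integral_map (by fun_prop) (by fun_prop)]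

theorem integrable_norm_sq_hadamard (hν : ∀ l, ν.map (fun h => h l) = pH)
    (hH : Integrable (fun t : ℝ => t ^ 2) pH) (x : E) :
    Integrable (fun h => ‖hadamard h x‖ ^ 2) ν := by
  simp only [norm_sq_hadamard]
  exact integrable_finsetSum _ fun l _ => (integrable_sq_coord hν hH l).mul_const _

theorem integral_norm_sq_hadamard (hν : ∀ l, ν.map (fun h => h l) = pH)
    (hH : Integrable (fun t : ℝ => t ^ 2) pH) (x : E) :
    ∫ h, ‖hadamard h x‖ ^ 2 ∂ν = secondMoment pH * ‖x‖ ^ 2 := by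
  simp only [norm_sq_hadamard]
  rw [integral_finsetSum _ fun l _ => (integrable_sq_coord hν hH l).mul_const _]
  simp [integral_mul_const, integral_sq_coord hν, EuclideanSpace.norm_sq_eq, Finset.mul_sum]

end Fading

/-! ### Bit and symbol probabilities, expectations over the bits, and the energy identity -/

namespace Constellation

variable (C : Constellation m N)

theorem bitProb_pos (k : Fin m) (u : Fin 2) : 0 < C.bitProb k u := by
  unfold bitProb
  split_ifs
  exacts [C.b_pos k, sub_pos.2 (C.b_lt_one k)]

theorem sum_bitProb (k : Fin m) : ∑ u, C.bitProb k u = 1 := by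
  simp [Fin.sum_univ_two, bitProb]

theorem symbolProb_finFunctionFinEquiv (c : Fin m → Fin 2) :
    C.symbolProb (finFunctionFinEquiv c) = ∏ k, C.bitProb k (c k) := by
  simp [symbolProb, nbc_finFunctionFinEquiv]

theorem symbolProb_nonneg (i : Fin (2 ^ m)) : 0 ≤ C.symbolProb i :=
  Finset.prod_nonneg fun k _ => (C.bitProb_pos k _).le

theorem sum_symbolProb : ∑ i, C.symbolProb i = 1 := by
  rw [← finFunctionFinEquiv.sum_comp]
  simp only [symbolProb_finFunctionFinEquiv]
  rw [← Fintype.prod_sum]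
  simp only [sum_bitProb, Finset.prod_const_one]

/-- The constraint on bit `k` is absorbed into the `k`-th factor, so the sum still factorises over
the bits; every other factor sums to one. -/
theorem sum_symbolProb_of_nbc_eq (k : Fin m) (u : Fin 2) :
    ∑ i, (if nbc i k = u then C.symbolProb i else 0) = C.bitProb k u := by
  rw [← finFunctionFinEquiv.sum_comp]
  simp only [symbolProb_finFunctionFinEquiv, nbc_finFunctionFinEquiv]
  have h (c : Fin m → Fin 2) : (if c k = u then ∏ k', C.bitProb k' (c k') else 0) =
      ∏ k', (if k' = k ∧ c k' ≠ u then 0 else C.bitProb k' (c k')) := by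
    split_ifs with hc
    · refine Finset.prod_congr rfl fun k' _ => (if_neg ?_).symm
      rintro ⟨rfl, h⟩
      exact h hc
    · refine (Finset.prod_eq_zero (Finset.mem_univ k) ?_).symm
      exact if_pos (And.intro rfl hc)
  simp only [h]
  rw [← Fintype.prod_sum fun k' v => if k' = k ∧ v ≠ u then 0 else C.bitProb k' v,
    Finset.prod_eq_single k _ (by simp)]
  · simp
  · intro k' _ hk'
    simp only [hk', false_and, if_false, sum_bitProb]

theorem symbolProb_mem_stdSimplex : C.symbolProb ∈ stdSimplex ℝ (Fin (2 ^ m)) :=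
  ⟨C.symbolProb_nonneg, C.sum_symbolProb⟩

/-- The distribution of the symbol index given that bit `k` equals `u`. -/
def bitWeight (k : Fin m) (u : Fin 2) (i : Fin (2 ^ m)) : ℝ :=
  if nbc i k = u then C.symbolProb i / C.bitProb k u else 0

theorem bitProb_mul_bitWeight (k : Fin m) (u : Fin 2) (i : Fin (2 ^ m)) :
    C.bitProb k u * C.bitWeight k u i = if nbc i k = u then C.symbolProb i else 0 := by
  rw [bitWeight, mul_ite, mul_zero, mul_div_cancel₀ _ (C.bitProb_pos k u).ne']

theorem bitWeight_mem_stdSimplex (k : Fin m) (u : Fin 2) :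
    C.bitWeight k u ∈ stdSimplex ℝ (Fin (2 ^ m)) := by
  refine ⟨fun i => ?_, ?_⟩
  · unfold bitWeight
    split_ifs
    exacts [div_nonneg (C.symbolProb_nonneg i) (C.bitProb_pos k u).le, le_rfl]
  · refine mul_left_cancel₀ (C.bitProb_pos k u).ne' ?_
    simp only [Finset.mul_sum, bitProb_mul_bitWeight, sum_symbolProb_of_nbc_eq, mul_one]

instance isProbabilityMeasure_bitLaw (k : Fin m) : IsProbabilityMeasure
    (∑ u : Fin 2, ENNReal.ofReal (C.bitProb k u) • Measure.dirac u) := by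
  constructor
  simp only [Measure.coe_finsetSum, Measure.smul_apply, Finset.sum_apply, measure_univ,
    smul_eq_mul, mul_one]
  rw [← ENNReal.ofReal_sum_of_nonneg fun u _ => (C.bitProb_pos k u).le, sum_bitProb,
    ENNReal.ofReal_one]

instance isProbabilityMeasure_bitsLaw : IsProbabilityMeasure C.bitsLaw := by
  unfold bitsLaw
  infer_instance

theorem bitsLaw_real_singleton (c : Fin m → Fin 2) :
    C.bitsLaw.real {c} = C.symbolProb (finFunctionFinEquiv c) := by
  rw [Measure.real, bitsLaw, Measure.pi_singleton, symbolProb_finFunctionFinEquiv,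
    ENNReal.toReal_prod]
  refine Finset.prod_congr rfl fun k _ => ?_
  simp only [Measure.coe_finsetSum, Finset.sum_apply, Measure.smul_apply, smul_eq_mul,
    Measure.dirac_apply' _ (MeasurableSet.singleton _), Set.indicator_apply,
    Set.mem_singleton_iff, Pi.one_apply, mul_ite, mul_one, mul_zero, Finset.sum_ite_eq',
    Finset.mem_univ, if_true]
  exact ENNReal.toReal_ofReal (C.bitProb_pos k _).le

/-- An expectation over the bits is a weighted sum over the symbol indices. -/
theorem integral_bitsLaw {F : Type*} [NormedAddCommGroup F] [NormedSpace ℝ F] [CompleteSpace F]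
    (f : (Fin m → Fin 2) → F) :
    ∫ c, f c ∂C.bitsLaw = ∑ i, C.symbolProb i • f (finFunctionFinEquiv.symm i) := by
  rw [integral_fintype .of_finite, ← finFunctionFinEquiv.sum_comp]
  simp [bitsLaw_real_singleton]

theorem mean_eq : C.mean = ∑ i, C.symbolProb i • C.x i := by
  simp [mean, symbol, integral_bitsLaw]

theorem energy_eq : C.energy = ∑ i, C.symbolProb i * ‖C.x i‖ ^ 2 := by
  simp [energy, symbol, integral_bitsLaw]

theorem energy_pos (hC : ∃ i, C.x i ≠ 0) : 0 < C.energy := by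
  obtain ⟨i, hi⟩ := hC
  rw [energy_eq]
  refine Finset.sum_pos' (fun j _ => mul_nonneg (C.symbolProb_nonneg j) (sq_nonneg _))
    ⟨i, Finset.mem_univ i, mul_pos (Finset.prod_pos fun k _ => C.bitProb_pos k _) ?_⟩
  have := norm_pos_iff.2 hi
  positivity

/-- The noiseless received symbols when the fading vector is `h`. -/
def faded (h : E) (i : Fin (2 ^ m)) : E := hadamard h (C.x i)

theorem continuous_faded (i : Fin (2 ^ m)) : Continuous fun h => C.faded h i :=
  continuous_hadamard_left _

theorem continuous_mixture_faded (w : Fin (2 ^ m) → ℝ) :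
    Continuous fun p : E × E => mixture w (C.faded p.1) p.2 := by
  unfold mixture likelihood
  have h i := (C.continuous_faded i).comp (continuous_fst (X := E) (Y := E))
  simp only [Function.comp_def] at h
  fun_prop

theorem scale_scale (r s : ℝ) : (C.scale r).scale s = C.scale (s * r) := by
  simp [scale, smul_smul]

theorem faded_scale (r : ℝ) (h : E) : (C.scale r).faded h = r • C.faded h :=
  funext fun i => hadamard_smul h (C.x i) r

theorem energy_scale (r : ℝ) : (C.scale r).energy = r ^ 2 * C.energy := by
  rw [energy_eq, energy_eq, Finset.mul_sum]
  refine Finset.sum_congr rfl fun i _ => ?_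
  change C.symbolProb i * ‖r • C.x i‖ ^ 2 = _
  rw [norm_smul, mul_pow, Real.norm_eq_abs, sq_abs]
  ring

/-- The between-class energy of the conditional means given bit `k`, as a double sum. -/
theorem sum_bitProb_mul_norm_sq_sub (k : Fin m) :
    ∑ u, C.bitProb k u * ‖∑ i, C.bitWeight k u i • C.x i‖ ^ 2 -
        ‖∑ i, C.symbolProb i • C.x i‖ ^ 2 =
      ∑ i, C.symbolProb i * ∑ j, C.symbolProb j * inner ℝ (C.x i) (C.x j) *
        ((-1) ^ ((nbc i k : ℕ) + (nbc j k : ℕ)) *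
          (C.bitProb k (1 - nbc i k) / C.bitProb k (nbc j k))) := by
  have hsq (w : Fin (2 ^ m) → ℝ) : ‖∑ i, w i • C.x i‖ ^ 2 =
      ∑ i, ∑ j, w i * w j * inner ℝ (C.x i) (C.x j) := by
    rw [← real_inner_self_eq_norm_sq]
    simp only [sum_inner, inner_sum, inner_smul_left, inner_smul_right, RCLike.conj_to_real]
    rw [Finset.sum_congr rfl fun i _ => Finset.mul_sum _ _ _, Finset.sum_comm]
    exact Finset.sum_congr rfl fun i _ => Finset.sum_congr rfl fun j _ => by ring
  simp only [hsq, Fin.sum_univ_two, Finset.mul_sum, ← Finset.sum_add_distrib,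
    ← Finset.sum_sub_distrib]
  refine Finset.sum_congr rfl fun i _ => Finset.sum_congr rfl fun j _ => ?_
  have h0 : C.bitProb k 0 ≠ 0 := (C.bitProb_pos k 0).ne'
  have h1 : C.bitProb k 1 ≠ 0 := (C.bitProb_pos k 1).ne'
  have hs : C.bitProb k 1 = 1 - C.bitProb k 0 := by
    have := C.sum_bitProb k
    rw [Fin.sum_univ_two] at this
    linarith
  have hcase (u : Fin 2) : u = 0 ∨ u = 1 := by fin_cases u <;> simp
  unfold bitWeight
  -- The coefficient of `P_i P_j ⟨x_i, x_j⟩` on the left is `1 / P(n) - 1 = P(n̄) / P(n)` when the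
  -- bits agree, and `-1` when they differ; in that case `n̄_i = n_j`, so the ratio on the right is
  -- `1`.
  rcases hcase (nbc i k) with hi | hi <;> rcases hcase (nbc j k) with hj | hj <;>
    simp [hi, hj] <;> field_simp <;> simp [hs]

end Constellation

/-! ### From information densities to relative entropies at unit noise level -/

variable (C : Constellation m N)

theorem unitNoiseDensity_pos (z : E) : 0 < unitNoiseDensity z := by
  unfold unitNoiseDensity
  positivity

theorem channelPdf_one (y x h : E) :
    channelPdf 1 y x h = unitNoiseDensity y * likelihood (hadamard h x) y :=
  unitNoiseDensity_sub (hadamard h x) y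

theorem outputPdf_one (y h : E) :
    outputPdf C 1 y h = unitNoiseDensity y * mixture C.symbolProb (C.faded h) y := by
  simp only [outputPdf, mixture, channelPdf_one, Finset.mul_sum, Constellation.faded]
  exact Finset.sum_congr rfl fun i _ => by ring

theorem bitOutputPdf_one (k : Fin m) (y h : E) (u : Fin 2) :
    bitOutputPdf C 1 k y h u = unitNoiseDensity y * mixture (C.bitWeight k u) (C.faded h) y := by
  simp only [bitOutputPdf, mixture, channelPdf_one, Finset.mul_sum, Constellation.faded,
    Constellation.bitWeight, Finset.sum_filter]
  refine Finset.sum_congr rfl fun i _ => ?_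
  split_ifs <;> ring

/-- The logarithm of `p_{Y|H,C_k}(y|h,u) / p_{Y|H}(y|h)` at noise level `N₀ = 1`. -/
def logRatio (k : Fin m) (u : Fin 2) (h y : E) : ℝ :=
  Real.log (mixture (C.bitWeight k u) (C.faded h) y) -
    Real.log (mixture C.symbolProb (C.faded h) y)

theorem infoDensity_one (k : Fin m) (ω : (Fin m → Fin 2) × E × E) :
    infoDensity C 1 k ω = logRatio C k (ω.1 k) ω.2.1 (received C ω) / Real.log 2 := by
  rw [infoDensity, bitOutputPdf_one, outputPdf_one,
    mul_div_mul_left _ _ (unitNoiseDensity_pos _).ne', Real.logb, logRatio,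
    Real.log_div (mixture_pos (C.bitWeight_mem_stdSimplex k _) _ _).ne'
      (mixture_pos C.symbolProb_mem_stdSimplex _ _).ne']

theorem continuous_logRatio (k : Fin m) (u : Fin 2) :
    Continuous fun p : E × E => logRatio C k u p.1 p.2 :=
  ((C.continuous_mixture_faded _).log fun _ =>
      (mixture_pos (C.bitWeight_mem_stdSimplex k u) _ _).ne').sub
    ((C.continuous_mixture_faded _).log fun _ => (mixture_pos C.symbolProb_mem_stdSimplex _ _).ne')

theorem continuous_faded_add (i : Fin (2 ^ m)) :
    Continuous fun p : E × E => (p.1, C.faded p.1 i + p.2) :=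
  continuous_fst.prodMk (((C.continuous_faded i).comp continuous_fst).add continuous_snd)

theorem continuous_logRatio_add (k : Fin m) (u : Fin 2) (i : Fin (2 ^ m)) :
    Continuous fun p : E × E => logRatio C k u p.1 (C.faded p.1 i + p.2) :=
  Continuous.comp (g := fun p : E × E => logRatio C k u p.1 p.2)
    (f := fun p : E × E => (p.1, C.faded p.1 i + p.2))
    (continuous_logRatio C k u) (continuous_faded_add C i)

theorem measurable_infoDensity_one (k : Fin m) : Measurable (infoDensity C 1 k) := by
  refine measurable_from_prod_countable_right fun c => ?_
  simp only [infoDensity_one]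
  exact ((continuous_logRatio_add C k (c k) (finFunctionFinEquiv c)).measurable).div_const _

/-- Only squares of norms appear on the right, so log-likelihoods are integrable under a
second-moment condition on the fading. -/
theorem abs_exponent_add_le (a b z : E) :
    |2 * inner ℝ (b + z) a - ‖a‖ ^ 2| ≤ ‖z‖ ^ 2 + (‖b‖ ^ 2 + 3 * ‖a‖ ^ 2) := by
  have h1 := abs_real_inner_le_norm (b + z) a
  have h2 := mul_le_mul_of_nonneg_right (norm_add_le b z) (norm_nonneg a)
  obtain ⟨h3, h4⟩ := abs_le.1 (h1.trans h2)
  rw [abs_le]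
  constructor <;> nlinarith [sq_nonneg (‖b‖ - ‖a‖), sq_nonneg (‖z‖ - ‖a‖), sq_nonneg ‖a‖]

section Fading

variable {ν : Measure (EuclideanSpace ℝ (Fin N))} {pH : Measure ℝ}

theorem stronglyMeasurable_mixtureKL_faded (w : Fin (2 ^ m) → ℝ) :
    StronglyMeasurable fun h => mixtureKL w (C.faded h) :=
  StronglyMeasurable.integral_prod_right (f := fun h z => klFun (mixture w (C.faded h) z))
    (continuous_klFun.comp (C.continuous_mixture_faded w)).stronglyMeasurable

theorem integrable_sum_norm_sq_faded (hν : ∀ l, ν.map (fun h => h l) = pH)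
    (hH : Integrable (fun t : ℝ => t ^ 2) pH) (w : Fin (2 ^ m) → ℝ) :
    Integrable (fun h => ∑ i, w i * ‖C.faded h i‖ ^ 2) ν :=
  integrable_finsetSum _ fun i _ => (integrable_norm_sq_hadamard hν hH (C.x i)).const_mul (w i)

theorem integrable_mixtureKL_faded (hν : ∀ l, ν.map (fun h => h l) = pH)
    (hH : Integrable (fun t : ℝ => t ^ 2) pH) {w : Fin (2 ^ m) → ℝ}
    (hw : w ∈ stdSimplex ℝ (Fin (2 ^ m))) : Integrable (fun h => mixtureKL w (C.faded h)) ν := by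
  refine (integrable_sum_norm_sq_faded C hν hH w).mono'
    (stronglyMeasurable_mixtureKL_faded C w).aestronglyMeasurable (.of_forall fun h => ?_)
  rw [Real.norm_of_nonneg (mixtureKL_nonneg hw _)]
  exact mixtureKL_le hw _

/-- The second dominated convergence, over the fading: the majorant from `mixtureKL_le` scales
exactly as `r ^ 2`, so the quotient is dominated uniformly in `r ≠ 0`. -/
theorem tendsto_integral_mixtureKL_div_sq (hν : ∀ l, ν.map (fun h => h l) = pH)
    (hH : Integrable (fun t : ℝ => t ^ 2) pH) {w : Fin (2 ^ m) → ℝ}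
    (hw : w ∈ stdSimplex ℝ (Fin (2 ^ m))) :
    Tendsto (fun r : ℝ => (∫ h, mixtureKL w ((C.scale r).faded h) ∂ν) / r ^ 2) (𝓝[≠] 0)
      (𝓝 (secondMoment pH * ‖∑ i, w i • C.x i‖ ^ 2)) := by
  rw [← integral_norm_sq_hadamard hν hH]
  simp only [← integral_div, hadamard_sum]
  refine tendsto_integral_filter_of_dominated_convergence
    (fun h => ∑ i, w i * ‖C.faded h i‖ ^ 2)
    (.of_forall fun r => ?_) ?_ (integrable_sum_norm_sq_faded C hν hH w) (.of_forall fun h => ?_)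
  · exact ((integrable_mixtureKL_faded (C.scale r) hν hH hw).div_const _).aestronglyMeasurable
  · filter_upwards [self_mem_nhdsWithin] with r (hr : r ≠ 0)
    refine .of_forall fun h => ?_
    rw [Real.norm_of_nonneg (div_nonneg (mixtureKL_nonneg hw _) (sq_nonneg r)),
      div_le_iff₀ (by positivity)]
    refine (mixtureKL_le hw _).trans_eq ?_
    rw [C.faded_scale, Finset.sum_mul]
    refine Finset.sum_congr rfl fun i _ => ?_
    rw [Pi.smul_apply, norm_smul, mul_pow, Real.norm_eq_abs, sq_abs]
    ring
  · simp only [C.faded_scale]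
    exact tendsto_mixtureKL_smul_div_sq hw (C.faded h)

variable [IsProbabilityMeasure ν]

theorem integrable_log_mixture_faded (hν : ∀ l, ν.map (fun h => h l) = pH)
    (hH : Integrable (fun t : ℝ => t ^ 2) pH) {w : Fin (2 ^ m) → ℝ}
    (hw : w ∈ stdSimplex ℝ (Fin (2 ^ m))) (i : Fin (2 ^ m)) :
    Integrable (fun p : E × E => Real.log (mixture w (C.faded p.1) (C.faded p.1 i + p.2)))
      (ν.prod (noiseLaw N 1)) := by
  have hint j : Integrable (fun p : E × E =>
      ‖p.2‖ ^ 2 + (‖C.faded p.1 i‖ ^ 2 + 3 * ‖C.faded p.1 j‖ ^ 2)) (ν.prod (noiseLaw N 1)) :=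
    (integrable_sq_norm_noiseLaw_one.comp_snd ν).add
      (((integrable_norm_sq_hadamard hν hH (C.x i)).add
        ((integrable_norm_sq_hadamard hν hH (C.x j)).const_mul 3)).comp_fst (noiseLaw N 1))
  refine (integrable_finsetSum Finset.univ fun j _ => hint j).mono' ?_ (.of_forall fun p => ?_)
  · have hc := (C.continuous_mixture_faded w).comp (continuous_faded_add C i)
    exact (hc.log fun _ => (mixture_pos hw _ _).ne').aestronglyMeasurable
  · exact (abs_log_mixture_le hw _ _).trans
      (Finset.sum_le_sum fun j _ => abs_exponent_add_le _ _ _)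

theorem integrable_logRatio_add (hν : ∀ l, ν.map (fun h => h l) = pH)
    (hH : Integrable (fun t : ℝ => t ^ 2) pH) (k : Fin m) (u : Fin 2) (i : Fin (2 ^ m)) :
    Integrable (fun p : E × E => logRatio C k u p.1 (C.faded p.1 i + p.2))
      (ν.prod (noiseLaw N 1)) :=
  (integrable_log_mixture_faded C hν hH (C.bitWeight_mem_stdSimplex k u) i).sub
    (integrable_log_mixture_faded C hν hH C.symbolProb_mem_stdSimplex i)

theorem integrable_infoDensity_one (hν : ∀ l, ν.map (fun h => h l) = pH)
    (hH : Integrable (fun t : ℝ => t ^ 2) pH) (k : Fin m) :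
    Integrable (infoDensity C 1 k) (jointLaw C ν 1) := by
  refine (integrable_prod_iff (measurable_infoDensity_one C k).aestronglyMeasurable).2
    -- The bits take finitely many values, so integrability need only be checked for each fixed bit
    -- vector.
    ⟨.of_forall fun c => ?_, .of_finite⟩
  simp only [infoDensity_one]
  exact (integrable_logRatio_add C hν hH k (c k) (finFunctionFinEquiv c)).div_const _

theorem integrable_logRatio_add_right (k : Fin m) (u : Fin 2) (h : E) (i : Fin (2 ^ m)) :
    Integrable (fun z => logRatio C k u h (C.faded h i + z)) (noiseLaw N 1) := by
  have hlog {w : Fin (2 ^ m) → ℝ} (hw : w ∈ stdSimplex ℝ (Fin (2 ^ m))) :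
      Integrable (fun z => Real.log (mixture w (C.faded h) (C.faded h i + z))) (noiseLaw N 1) := by
    have hint j : Integrable (fun z : E =>
        ‖z‖ ^ 2 + (‖C.faded h i‖ ^ 2 + 3 * ‖C.faded h j‖ ^ 2)) (noiseLaw N 1) :=
      integrable_sq_norm_noiseLaw_one.add (integrable_const _)
    refine (integrable_finsetSum Finset.univ fun j _ => hint j).mono' ?_ (.of_forall fun z => ?_)
    · exact (((continuous_mixture w _).comp (continuous_const.add continuous_id)).log
        fun _ => (mixture_pos hw _ _).ne').aestronglyMeasurable
    · exact (abs_log_mixture_le hw _ _).trans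
        (Finset.sum_le_sum fun j _ => abs_exponent_add_le _ _ _)
  exact (hlog (C.bitWeight_mem_stdSimplex k u)).sub (hlog C.symbolProb_mem_stdSimplex)

theorem bitProb_mul_mixture (k : Fin m) (u : Fin 2) (a : Fin (2 ^ m) → E) (y : E) :
    C.bitProb k u * mixture (C.bitWeight k u) a y =
      ∑ i, if nbc i k = u then C.symbolProb i * likelihood (a i) y else 0 := by
  simp only [mixture, Finset.mul_sum, ← mul_assoc, C.bitProb_mul_bitWeight, ite_mul, zero_mul]

theorem sum_bitProb_mul_mixture (k : Fin m) (a : Fin (2 ^ m) → E) (y : E) :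
    ∑ u, C.bitProb k u * mixture (C.bitWeight k u) a y = mixture C.symbolProb a y := by
  simp only [bitProb_mul_mixture]
  rw [Finset.sum_comm]
  simp only [Finset.sum_ite_eq, Finset.mem_univ, if_true, mixture]

/-- Compensation identity, pointwise in `y`: grouping symbols by bit `k` gives `∑ p_u f_u (log f_u -
log f)`. Since `∑ p_u f_u = f` and `∑ p_u = 1`, the affine parts of `klFun` cancel. -/
theorem sum_symbolProb_mul_logRatio (k : Fin m) (h y : E) :
    ∑ i, C.symbolProb i * (likelihood (C.faded h i) y * logRatio C k (nbc i k) h y) =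
      ∑ u, C.bitProb k u * klFun (mixture (C.bitWeight k u) (C.faded h) y) -
        klFun (mixture C.symbolProb (C.faded h) y) := by
  have h1 : ∑ i, C.symbolProb i * (likelihood (C.faded h i) y * logRatio C k (nbc i k) h y) =
      ∑ u, C.bitProb k u * mixture (C.bitWeight k u) (C.faded h) y * logRatio C k u h y := by
    simp only [bitProb_mul_mixture, Finset.sum_mul, ite_mul, zero_mul]
    rw [Finset.sum_comm]
    simp only [Finset.sum_ite_eq, Finset.mem_univ, if_true, mul_assoc]
  have h2 := C.sum_bitProb k
  have h3 := sum_bitProb_mul_mixture C k (C.faded h) y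
  rw [h1]
  simp only [Fin.sum_univ_two, logRatio, klFun_apply] at h2 h3 ⊢
  linear_combination (-Real.log (mixture C.symbolProb (C.faded h) y) + 1) * h3 - h2

/-- Each term averages over a differently shifted noise. Rewriting the shifts as likelihood weights
puts all terms under one measure, where the pointwise identity applies. -/
theorem sum_symbolProb_mul_integral_logRatio (k : Fin m) (h : E) :
    ∑ i, C.symbolProb i * ∫ z, logRatio C k (nbc i k) h (C.faded h i + z) ∂noiseLaw N 1 =
      ∑ u, C.bitProb k u * mixtureKL (C.bitWeight k u) (C.faded h) -
        mixtureKL C.symbolProb (C.faded h) := by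
  have hl i := (integrable_noiseLaw_one_add (C.faded h i)).1
    (integrable_logRatio_add_right C k (nbc i k) h i)
  have hu u := (integrable_klFun_mixture (C.bitWeight_mem_stdSimplex k u) (C.faded h)).const_mul
    (C.bitProb k u)
  simp only [integral_noiseLaw_one_add, mixtureKL, ← integral_const_mul]
  rw [← integral_finsetSum _ fun i _ => (hl i).const_mul _, ← integral_finsetSum _ fun u _ => hu u,
    ← integral_sub (integrable_finsetSum _ fun u _ => hu u)
      (integrable_klFun_mixture C.symbolProb_mem_stdSimplex _)]
  simp only [sum_symbolProb_mul_logRatio]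

/-- At unit noise level the mutual information of a bit is a difference of relative entropies. -/
theorem bitMI_one (hν : ∀ l, ν.map (fun h => h l) = pH)
    (hH : Integrable (fun t : ℝ => t ^ 2) pH) (k : Fin m) :
    bitMI C ν 1 k =
      (∑ u, C.bitProb k u * ∫ h, mixtureKL (C.bitWeight k u) (C.faded h) ∂ν -
        ∫ h, mixtureKL C.symbolProb (C.faded h) ∂ν) / Real.log 2 := by
  have hu u := (integrable_mixtureKL_faded C hν hH (C.bitWeight_mem_stdSimplex k u)).const_mul
    (C.bitProb k u)
  have hl i := (integrable_logRatio_add C hν hH k (nbc i k) i).integral_prod_left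
  rw [bitMI, jointLaw, integral_prod _ (integrable_infoDensity_one C hν hH k),
    C.integral_bitsLaw]
  have e (i : Fin (2 ^ m)) (p : E × E) :
      infoDensity C 1 k (finFunctionFinEquiv.symm i, p) =
        logRatio C k (nbc i k) p.1 (C.faded p.1 i + p.2) / Real.log 2 := by
    rw [infoDensity_one, received, Constellation.symbol, Equiv.apply_symm_apply]
    rfl
  simp only [e, integral_div, smul_eq_mul, ← mul_div_assoc, ← Finset.sum_div]
  congr 1
  calc ∑ i, C.symbolProb i *
        ∫ p, logRatio C k (nbc i k) p.1 (C.faded p.1 i + p.2) ∂ν.prod (noiseLaw N 1)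
      = ∑ i, ∫ h, C.symbolProb i *
          ∫ z, logRatio C k (nbc i k) h (C.faded h i + z) ∂noiseLaw N 1 ∂ν :=
        Finset.sum_congr rfl fun i _ => by
          rw [integral_prod _ (integrable_logRatio_add C hν hH k _ _), integral_const_mul]
    _ = ∫ h, ∑ u, C.bitProb k u * mixtureKL (C.bitWeight k u) (C.faded h) -
          mixtureKL C.symbolProb (C.faded h) ∂ν := by
        rw [← integral_finsetSum _ fun i _ => (hl i).const_mul _]
        simp only [sum_symbolProb_mul_integral_logRatio]
    _ = _ := by
        rw [integral_sub (integrable_finsetSum _ fun u _ => hu u)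
          (integrable_mixtureKL_faded C hν hH C.symbolProb_mem_stdSimplex),
          integral_finsetSum _ fun u _ => hu u]
        simp only [integral_const_mul]

theorem tendsto_bitMI_scale_div_sq (hν : ∀ l, ν.map (fun h => h l) = pH)
    (hH : Integrable (fun t : ℝ => t ^ 2) pH) (k : Fin m) :
    Tendsto (fun r : ℝ => bitMI (C.scale r) ν 1 k / r ^ 2) (𝓝[≠] 0)
      (𝓝 (secondMoment pH * (∑ u, C.bitProb k u * ‖∑ i, C.bitWeight k u i • C.x i‖ ^ 2 -
        ‖∑ i, C.symbolProb i • C.x i‖ ^ 2) / Real.log 2)) := by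
  have h1 := tendsto_finsetSum Finset.univ fun u _ =>
    (tendsto_integral_mixtureKL_div_sq C hν hH (C.bitWeight_mem_stdSimplex k u)).const_mul
      (C.bitProb k u)
  have h2 := (h1.sub (tendsto_integral_mixtureKL_div_sq C hν hH
    C.symbolProb_mem_stdSimplex)).div_const (Real.log 2)
  have e : secondMoment pH * (∑ u, C.bitProb k u * ‖∑ i, C.bitWeight k u i • C.x i‖ ^ 2 -
        ‖∑ i, C.symbolProb i • C.x i‖ ^ 2) =
      ∑ u, C.bitProb k u * (secondMoment pH * ‖∑ i, C.bitWeight k u i • C.x i‖ ^ 2) -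
        secondMoment pH * ‖∑ i, C.symbolProb i • C.x i‖ ^ 2 := by
    rw [mul_sub, Finset.mul_sum]
    congr 1
    exact Finset.sum_congr rfl fun u _ => by ring
  rw [e]
  refine h2.congr fun r => ?_
  rw [bitMI_one (C.scale r) hν hH k, div_right_comm]
  refine congrArg (· / Real.log 2) ?_
  rw [sub_div, Finset.sum_div]
  exact congrArg (· - _) (Finset.sum_congr rfl fun u _ => (mul_div_assoc _ _ _).symm)

theorem bitMI_scale_zero (hν : ∀ l, ν.map (fun h => h l) = pH)
    (hH : Integrable (fun t : ℝ => t ^ 2) pH) (k : Fin m) : bitMI (C.scale 0) ν 1 k = 0 := by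
  have h {w : Fin (2 ^ m) → ℝ} (hw : w ∈ stdSimplex ℝ (Fin (2 ^ m))) (h : E) :
      mixtureKL w ((C.scale 0).faded h) = 0 := by
    simp only [mixtureKL, C.faded_scale, mixture_zero_smul hw, klFun_one, integral_zero]
  rw [bitMI_one (C.scale 0) hν hH k]
  simp [h (C.bitWeight_mem_stdSimplex k _), h C.symbolProb_mem_stdSimplex,
    show (C.scale 0).bitWeight = C.bitWeight from rfl,
    show (C.scale 0).symbolProb = C.symbolProb from rfl]

end Fading

/-! ### Reduction of an arbitrary noise level to the unit one -/

section NoiseLevel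

/-- The rescaling of the noise by a factor `c`. -/
def noiseScaling (m N : ℕ) {c : ℝ} (hc : c ≠ 0) :
    ((Fin m → Fin 2) × EuclideanSpace ℝ (Fin N) × EuclideanSpace ℝ (Fin N)) ≃ᵐ
      ((Fin m → Fin 2) × EuclideanSpace ℝ (Fin N) × EuclideanSpace ℝ (Fin N)) :=
  (MeasurableEquiv.refl _).prodCongr
    ((MeasurableEquiv.refl _).prodCongr (MeasurableEquiv.smul₀ c hc))

theorem jointLaw_sq_eq_map (ν : Measure E) [IsProbabilityMeasure ν] {c : ℝ} (hc : 0 < c) :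
    jointLaw C ν (c ^ 2) = (jointLaw C ν 1).map (noiseScaling m N hc.ne') := by
  rw [show ⇑(noiseScaling m N hc.ne') = Prod.map id (Prod.map id (c • ·)) from rfl, jointLaw,
    jointLaw, noiseLaw_sq_eq_map hc,
    ← Measure.map_prod_map _ _ measurable_id (by fun_prop),
    ← Measure.map_prod_map _ _ measurable_id (by fun_prop), Measure.map_id, Measure.map_id]

theorem channelPdf_sq {c : ℝ} (hc : 0 < c) (y x h : E) :
    channelPdf (c ^ 2) (c • y) x h =
      (Real.pi ^ ((N : ℝ) / 2) / (c ^ 2 * Real.pi) ^ ((N : ℝ) / 2)) *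
        channelPdf 1 y (c⁻¹ • x) h := by
  have e : c • y - hadamard h x = c • (y - hadamard h (c⁻¹ • x)) := by
    rw [hadamard_smul, smul_sub, smul_inv_smul₀ hc.ne']
  have hexp : -‖c • y - hadamard h x‖ ^ 2 / c ^ 2 = -‖y - hadamard h (c⁻¹ • x)‖ ^ 2 / 1 := by
    rw [e, norm_smul, Real.norm_of_nonneg hc.le]
    field_simp
  have : (0 : ℝ) < Real.pi ^ ((N : ℝ) / 2) := by positivity
  rw [channelPdf, channelPdf, hexp, one_mul]
  field_simp

/-- Dividing the output by `c` divides noise and symbols alike. The densities change by a constant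
`K` independent of symbol and bit, which cancels in the ratio. -/
theorem infoDensity_sq {c : ℝ} (hc : 0 < c) (k : Fin m) (ω : (Fin m → Fin 2) × E × E) :
    infoDensity C (c ^ 2) k (noiseScaling m N hc.ne' ω) = infoDensity (C.scale c⁻¹) 1 k ω := by
  obtain ⟨b, h, z⟩ := ω
  have hr : received C (b, h, c • z) = c • received (C.scale c⁻¹) (b, h, z) := by
    change hadamard h (C.symbol b) + c • z = c • (hadamard h (c⁻¹ • C.symbol b) + z)
    rw [hadamard_smul, smul_add, smul_inv_smul₀ hc.ne']
  set K := Real.pi ^ ((N : ℝ) / 2) / (c ^ 2 * Real.pi) ^ ((N : ℝ) / 2) with hK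
  have hK0 : K ≠ 0 := by positivity
  have hout (y : E) : outputPdf C (c ^ 2) (c • y) h = K * outputPdf (C.scale c⁻¹) 1 y h := by
    simp only [outputPdf, channelPdf_sq hc, ← hK, Finset.mul_sum]
    exact Finset.sum_congr rfl fun i _ => mul_left_comm _ _ _
  have hbit (y : E) : bitOutputPdf C (c ^ 2) k (c • y) h (b k) =
      K * bitOutputPdf (C.scale c⁻¹) 1 k y h (b k) := by
    simp only [bitOutputPdf, channelPdf_sq hc, ← hK, Finset.mul_sum]
    exact Finset.sum_congr rfl fun i _ => mul_left_comm _ _ _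
  change infoDensity C (c ^ 2) k (b, h, c • z) = _
  simp only [infoDensity, hr, hout, hbit, mul_div_mul_left _ _ hK0]

variable {ν : Measure (EuclideanSpace ℝ (Fin N))} [IsProbabilityMeasure ν] {pH : Measure ℝ}

theorem integrable_infoDensity (hν : ∀ l, ν.map (fun h => h l) = pH)
    (hH : Integrable (fun t : ℝ => t ^ 2) pH) {N₀ : ℝ} (hN₀ : 0 < N₀) (k : Fin m) :
    Integrable (infoDensity C N₀ k) (jointLaw C ν N₀) := by
  obtain ⟨c, hc, rfl⟩ : ∃ c : ℝ, 0 < c ∧ c ^ 2 = N₀ := ⟨√N₀, Real.sqrt_pos.2 hN₀, Real.sq_sqrt hN₀.le⟩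
  rw [jointLaw_sq_eq_map C ν hc, integrable_map_equiv]
  exact (integrable_infoDensity_one (C.scale c⁻¹) hν hH k).congr
    (.of_forall fun ω => (infoDensity_sq C hc k ω).symm)

theorem bicmGMI_sq (ν : Measure E) [IsProbabilityMeasure ν] {c : ℝ} (hc : 0 < c) :
    bicmGMI C ν (c ^ 2) = bicmGMI (C.scale c⁻¹) ν 1 := by
  refine Finset.sum_congr rfl fun k _ => ?_
  rw [bitMI, jointLaw_sq_eq_map C ν hc, integral_map_equiv]
  simp only [infoDensity_sq C hc]
  rfl

theorem bicmGMI_scale_eq_gmiOfSNR (hC : 0 < C.energy) (ν : Measure E) [IsProbabilityMeasure ν]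
    (hH0 : 0 < secondMoment pH) {r : ℝ} (hr : 0 ≤ r) {N₀ : ℝ} (hN₀ : 0 < N₀) :
    bicmGMI (C.scale r) ν N₀ = gmiOfSNR C ν pH (snr (C.scale r) pH N₀) := by
  obtain ⟨c, hc, rfl⟩ : ∃ c : ℝ, 0 < c ∧ c ^ 2 = N₀ := ⟨√N₀, Real.sqrt_pos.2 hN₀, Real.sq_sqrt hN₀.le⟩
  -- Only the ratio of amplitude to noise scale `c⁻¹ * r` matters, and the SNR determines it because
  -- it is nonnegative.
  have e : secondMoment pH * (r ^ 2 * C.energy) / c ^ 2 / (secondMoment pH * C.energy) =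
      (c⁻¹ * r) ^ 2 := by
    field_simp
  rw [bicmGMI_sq _ ν hc, C.scale_scale, gmiOfSNR, snr, C.energy_scale, e,
    Real.sqrt_sq (by positivity)]

end NoiseLevel

/-! ### The derivative at zero SNR -/

theorem hasDerivWithinAt_gmiOfSNR (hC : 0 < C.energy) {ν : Measure E} [IsProbabilityMeasure ν]
    {pH : Measure ℝ} (hν : ∀ l, ν.map (fun h => h l) = pH)
    (hH : Integrable (fun t : ℝ => t ^ 2) pH) (hH0 : 0 < secondMoment pH) :
    HasDerivWithinAt (gmiOfSNR C ν pH)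
      (Real.logb 2 (Real.exp 1) / C.energy *
        ∑ k, (∑ u, C.bitProb k u * ‖∑ i, C.bitWeight k u i • C.x i‖ ^ 2 -
          ‖∑ i, C.symbolProb i • C.x i‖ ^ 2)) (Set.Ici 0) 0 := by
  rw [hasDerivWithinAt_iff_tendsto_slope, Set.Ici_sdiff_left]
  have hK : 0 < secondMoment pH * C.energy := by positivity
  -- The amplitude at SNR `s` tends to `0` through nonzero values, and its square is `s` over the
  -- constant. The quadratic limit in the amplitude thus becomes a slope in `s`.
  have hsqrt : Tendsto (fun s => √(s / (secondMoment pH * C.energy))) (𝓝[>] 0) (𝓝[≠] 0) := by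
    refine tendsto_nhdsWithin_iff.2 ⟨?_, ?_⟩
    · have : Continuous fun s => √(s / (secondMoment pH * C.energy)) := by fun_prop
      simpa using this.continuousAt (x := 0) |>.tendsto.mono_left nhdsWithin_le_nhds
    · filter_upwards [self_mem_nhdsWithin] with s (hs : 0 < s)
      exact (Real.sqrt_pos.2 (by positivity)).ne'
  have h1 := ((tendsto_finsetSum Finset.univ fun k _ =>
    tendsto_bitMI_scale_div_sq C hν hH k).comp hsqrt).div_const (secondMoment pH * C.energy)
  convert h1.congr' _ using 2
  · rw [← Finset.sum_div, ← Finset.mul_sum, Real.logb, Real.log_exp]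
    field_simp
  · filter_upwards [self_mem_nhdsWithin] with s (hs : 0 < s)
    have h0 : gmiOfSNR C ν pH 0 = 0 := by
      rw [gmiOfSNR, zero_div, Real.sqrt_zero]
      exact Finset.sum_eq_zero fun k _ => bitMI_scale_zero C hν hH k
    rw [slope_def_field, h0, sub_zero, sub_zero, Function.comp_apply, ← Finset.sum_div,
      Real.sq_sqrt (by positivity), gmiOfSNR, bicmGMI]
    field_simp

end BICM

end

theorem theorem5 {m N : ℕ} (C : BICM.Constellation m N)
    -- some symbol is nonzero, that is, the symbol energy is positive
    (hC : ∃ i, C.x i ≠ 0)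
    -- the law of the fading vector, whose coordinates all have the law `pH`
    (ν : MeasureTheory.Measure (EuclideanSpace ℝ (Fin N)))
    [MeasureTheory.IsProbabilityMeasure ν] (pH : MeasureTheory.Measure ℝ)
    (hν : ∀ l, ν.map (fun h => h l) = pH)
    (hH : MeasureTheory.Integrable (fun t : ℝ => t ^ 2) pH)
    (hH0 : 0 < BICM.secondMoment pH) :
    C.mean = ∑ i, C.symbolProb i • C.x i ∧
    C.energy = ∑ i, C.symbolProb i * ‖C.x i‖ ^ 2 ∧
    -- the mutual informations are expectations of integrable random variables
    (∀ r : ℝ, 0 ≤ r → ∀ N₀ : ℝ, 0 < N₀ → ∀ k,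
      MeasureTheory.Integrable (BICM.infoDensity (C.scale r) N₀ k)
        (BICM.jointLaw (C.scale r) ν N₀)) ∧
    -- whether the noise level or the scale of the alphabet varies, the BICM-GMI is the same
    -- function of the SNR
    (∀ r : ℝ, 0 ≤ r → ∀ N₀ : ℝ, 0 < N₀ →
      BICM.bicmGMI (C.scale r) ν N₀ =
        BICM.gmiOfSNR C ν pH (BICM.snr (C.scale r) pH N₀)) ∧
    -- the derivative of the BICM-GMI at zero SNR
    HasDerivWithinAt (BICM.gmiOfSNR C ν pH)
      (Real.logb 2 (Real.exp 1) / C.energy *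
        ∑ i, C.symbolProb i * ∑ j, C.symbolProb j * inner ℝ (C.x i) (C.x j) *
          ∑ k, (-1) ^ ((BICM.nbc i k : ℕ) + (BICM.nbc j k : ℕ)) *
            (C.bitProb k (1 - BICM.nbc i k) / C.bitProb k (BICM.nbc j k)))
      (Set.Ici 0) 0 := by
  have hE := C.energy_pos hC
  refine ⟨C.mean_eq, C.energy_eq,
    fun r _ N₀ hN₀ k => BICM.integrable_infoDensity (C.scale r) hν hH hN₀ k,
    fun r hr N₀ hN₀ => BICM.bicmGMI_scale_eq_gmiOfSNR C hE ν hH0 hr hN₀, ?_⟩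
  convert BICM.hasDerivWithinAt_gmiOfSNR C hE hν hH hH0 using 2
  simp only [C.sum_bitProb_mul_norm_sq_sub]
  -- The sum over bits is moved inside the sums over `i` and `j`.
  rw [Finset.sum_comm]
  refine Finset.sum_congr rfl fun i _ => ?_
  rw [← Finset.mul_sum, Finset.sum_comm]
  simp only [Finset.mul_sum]
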